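/- Let $G$ be a compact connected (real, finite-dimensional) Lie group with identity $e$ and Lie algebra $\mathfrak g\cong T_eG$ of left-invariant vector fields, and let $X_1,\dots,X_m\in\mathfrak g$ generate $\mathfrak g$ as a Lie algebra. Let $(x_r,u_1^r,\dots,u_m^r)$ be a $T$-periodic trajectory ($T>0$) of the system $x'=\sum_{k=1}^m u_kX_k(x)$; that is, $u_1^r,\dots,u_m^r:\mathbb R\to\mathbb R$ are smooth, $x_r:\mathbb R\to G$ satisfies $x_r'(t)=\sum_{k=1}^m u_k^r(t)X_k(x_r(t))$ for all $t\in\mathbb R$, and $x_r,u_1^r,\dots,u_m^r$ are all $T$-periodic. For $x\in G$ let $\mathrm{Ad}(x):\mathfrak g\to\mathfrak g$ be the differential at $e$ of $y\mapsto xyx^{-1}$, and put $V(x)=\mathrm{tr}\,\mathrm{Ad}(x)$. Define the time-dependent vector field $W$ on $G$ by $$W(t,w)=\sum_{k=1}^m a_k(t,w)\,\bigl(\mathrm{Ad}(x_r(t))X_k\bigr)(w),\qquad a_k(t,w)=\mathrm dV_w\bigl((\mathrm{Ad}(x_r(t))X_k)(w)\bigr),$$ where $\mathrm{Ad}(x_r(t))X_k\in\mathfrak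 g$ is regarded as a left-invariant vector field. A point $w\in G$ is a critical point of $W$ if $W(t,w)=0$ for all $t\in\mathbb R$. A critical point $w$ is a local attractor of $W$ if it has a neighborhood $U\subset G$ such that for every $(t_0,w_0)\in\mathbb R\times U$ the unique integral curve $\gamma:\mathbb R\to G$ of $W$ with $\gamma(t_0)=w_0$ satisfies $\lim_{t\to\infty}\gamma(t)=w$. Then every element of the center $Z(G)$ of $G$ is a critical point of $W$. Moreover, if $e$ is a local attractor of $W$, then $G$ is semisimple (that is, its Lie algebra $\mathfrak g$ is semisimple). -/

import Mathlib

open scoped Manifold ContDiff Topology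

noncomputable section

namespace PeriodicTracking

section TimeDependentFields

variable {E : Type*} [NormedAddCommGroup E] [NormedSpace ℝ E]
  {H : Type*} [TopologicalSpace H] {I : ModelWithCorners ℝ E H}
  {M : Type*} [TopologicalSpace M] [ChartedSpace H M]

/-- `γ : ℝ → M` is a (global) integral curve of the time-dependent vector field `Y`:
`γ'(t) = Y(t, γ(t))` for all `t`. -/
def IsIntegralCurve (γ : ℝ → M) (Y : ℝ → (x : M) → TangentSpace I x) : Prop :=
  ∀ t : ℝ, HasMFDerivAt 𝓘(ℝ, ℝ) I γ t ((1 : ℝ →L[ℝ] ℝ).smulRight (Y t (γ t)))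

/-- `w` is a critical point of the time-dependent vector field `Y`: `Y(t, w) = 0` for all `t`. -/
def IsCriticalPoint (Y : ℝ → (x : M) → TangentSpace I x) (w : M) : Prop :=
  ∀ t : ℝ, Y t w = 0

/-- `w` is a local attractor of the time-dependent vector field `Y`: it is a critical point, and
it has a neighborhood `U` such that, for every `(t₀, w₀) ∈ ℝ × U`, the integral curve `γ : ℝ → M`
of `Y` with `γ(t₀) = w₀` (which exists and is unique if `Y` is smooth and `M` is compact)
converges to `w` as `t → ∞`. -/
def IsLocalAttractor (Y : ℝ → (x : M) → TangentSpace I x) (w : M) : Prop :=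
  IsCriticalPoint Y w ∧
    ∃ U ∈ 𝓝 w, ∀ t₀ : ℝ, ∀ w₀ ∈ U, ∀ γ : ℝ → M,
      IsIntegralCurve γ Y → γ t₀ = w₀ → Filter.Tendsto γ Filter.atTop (𝓝 w)

end TimeDependentFields

section LieGroups

variable {E : Type*} [NormedAddCommGroup E] [NormedSpace ℝ E]
  {H : Type*} [TopologicalSpace H] {I : ModelWithCorners ℝ E H}
  {G : Type*} [TopologicalSpace G] [ChartedSpace H G] [Group G] {m : ℕ}

/-- The Lie algebra structure on `T_e G` requires only three derivatives. -/
instance instLieGroupMinSmoothness [LieGroup I ∞ G] : LieGroup I (minSmoothness ℝ 3) G :=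
  LieGroup.of_le (n := ∞) (by simpa using (ENat.LEInfty.out : (3 : ℕ∞ω) ≤ ∞))

/-- `X₁, …, X_m` is bracket-generating: the Lie algebra generated by them (equivalently, by their
linear span) is the whole Lie algebra of `G`. -/
def IsBracketGenerating [CompleteSpace E] [LieGroup I ∞ G]
    (X : Fin m → GroupLieAlgebra I G) : Prop :=
  LieSubalgebra.lieSpan ℝ (GroupLieAlgebra I G) (Set.range X) = ⊤

variable (I) in
/-- The adjoint map: `Ad(x)` is the differential at `e` of the conjugation `y ↦ x y x⁻¹`
(the target is the tangent space at `x e x⁻¹ = e`). -/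
def Ad (x : G) : GroupLieAlgebra I G →L[ℝ] GroupLieAlgebra I G :=
  mfderiv I I (fun y : G => x * y * x⁻¹) 1

variable (I) in
/-- The Lyapunov-like function `V(x) = tr Ad(x)`. -/
def V (x : G) : ℝ :=
  LinearMap.trace ℝ (GroupLieAlgebra I G) (Ad I x : GroupLieAlgebra I G →ₗ[ℝ] GroupLieAlgebra I G)

/-- The time-dependent vector field `(t, x) ↦ ∑ₖ uₖ(t) Xₖ(x)` of the driftless system with
controls `u`, where `Xₖ` is regarded as a left-invariant vector field. -/
def controlledField (X : Fin m → GroupLieAlgebra I G) (u : Fin m → ℝ → ℝ)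
    (t : ℝ) (x : G) : TangentSpace I x :=
  ∑ k, u k t • mulInvariantVectorField (X k) x

/-- `(x, u₁, …, u_m)` is a (smooth) `T`-periodic trajectory of the system
`x' = ∑ₖ uₖ Xₖ(x)`. -/
structure IsPeriodicTrajectory (X : Fin m → GroupLieAlgebra I G) (T : ℝ)
    (x : ℝ → G) (u : Fin m → ℝ → ℝ) : Prop where
  period_pos : 0 < T
  contDiff_control : ∀ k, ContDiff ℝ ∞ (u k)
  isIntegralCurve : IsIntegralCurve x (controlledField X u)
  periodic_curve : Function.Periodic x T
  periodic_control : ∀ k, Function.Periodic (u k) T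

/-- The left-invariant vector field `Ad(x_r(t)) Xₖ`, at the point `w`. -/
def adField (X : Fin m → GroupLieAlgebra I G) (xr : ℝ → G) (k : Fin m)
    (t : ℝ) (w : G) : TangentSpace I w :=
  mulInvariantVectorField (Ad I (xr t) (X k)) w

/-- The feedback coefficients `aₖ(t, w) = dV(Ad(x_r(t)) Xₖ(w))`. -/
def a (X : Fin m → GroupLieAlgebra I G) (xr : ℝ → G) (k : Fin m) (t : ℝ) (w : G) : ℝ :=
  mvfderiv I (V I : G → ℝ) w (adField X xr k t w)

/-- The auxiliary vector field `W(t, w) = ∑ₖ aₖ(t, w) Ad(x_r(t)) Xₖ(w)`. -/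
def W (X : Fin m → GroupLieAlgebra I G) (xr : ℝ → G) (t : ℝ) (w : G) : TangentSpace I w :=
  ∑ k, a X xr k t w • adField X xr k t w

end LieGroups

end PeriodicTracking

end

/-!
Averaging an inner product over the compact group `G` makes `Ad` orthogonal, so
`V = tr Ad ≤ dim 𝔤`, with equality wherever `Ad = id`. Such points, in particular the central ones,
are maxima of `V`, and there `dV` and hence `W` vanish.

The adjoint representation has derivative `ad`. If `z ≠ 0` were central in `𝔤`, then `Ad` would be
constant along the integral curve of `z` through `e`; this curve would consist of critical points
of `W` accumulating at `e`, whereas a local attractor is isolated among the critical points. Hence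
`𝔤` has trivial center, and since the averaged inner product is `ad`-invariant, `𝔤` is semisimple.
-/

open Filter VectorField MeasureTheory Module

namespace PeriodicTracking

section MixedDerivatives

variable {𝕜 E F G : Type*} [NontriviallyNormedField 𝕜]
  [NormedAddCommGroup E] [NormedSpace 𝕜 E] [NormedAddCommGroup F] [NormedSpace 𝕜 F]
  [NormedAddCommGroup G] [NormedSpace 𝕜 G] {f : E × F → G} {x : E} {y : F} {n : ℕ∞ω}

theorem fderiv_partial_left (hf : DifferentiableAt 𝕜 f (x, y)) (u : E) :
    fderiv 𝕜 (fun a ↦ f (a, y)) x u = fderiv 𝕜 f (x, y) (u, 0) := by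
  have h : HasFDerivAt (fun a ↦ f (a, y)) _ x :=
    HasFDerivAt.comp (g := f) x hf.hasFDerivAt (hasFDerivAt_prodMk_left x y)
  simp [h.fderiv]

theorem fderiv_partial_right (hf : DifferentiableAt 𝕜 f (x, y)) (v : F) :
    fderiv 𝕜 (fun b ↦ f (x, b)) y v = fderiv 𝕜 f (x, y) (0, v) := by
  have h : HasFDerivAt (fun b ↦ f (x, b)) _ y :=
    HasFDerivAt.comp (g := f) y hf.hasFDerivAt (hasFDerivAt_prodMk_right x y)
  simp [h.fderiv]

theorem differentiableAt_fderiv_left (hf : ContDiffAt 𝕜 n f (x, y)) (hn : 2 ≤ n) :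
    DifferentiableAt 𝕜 (fun b ↦ fderiv 𝕜 (fun a ↦ f (a, b)) x) y := by
  have hswap : ContDiffAt 𝕜 2 (Function.uncurry fun b a ↦ f (a, b)) (y, x) :=
    (hf.of_le hn).comp (y, x) (contDiffAt_snd.prodMk contDiffAt_fst)
  exact (hswap.fderiv (m := 1) contDiffAt_const (by norm_num)).differentiableAt (by simp)

theorem differentiableAt_fderiv (hf : ContDiffAt 𝕜 n f (x, y)) (hn : 2 ≤ n) :
    DifferentiableAt 𝕜 (fderiv 𝕜 f) (x, y) :=
  ((hf.of_le hn).fderiv_right (m := 1) (by norm_num)).differentiableAt (by simp)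

theorem fderiv_fderiv_right_apply (hf : ContDiffAt 𝕜 n f (x, y)) (hn : 2 ≤ n) (u : E) (v : F) :
    fderiv 𝕜 (fun a ↦ fderiv 𝕜 (fun b ↦ f (a, b)) y v) x u =
      fderiv 𝕜 (fderiv 𝕜 f) (x, y) (u, 0) (0, v) := by
  have hpartial : (fun a ↦ fderiv 𝕜 (fun b ↦ f (a, b)) y v) =ᶠ[𝓝 x]
      fun a ↦ fderiv 𝕜 f (a, y) (0, v) := by
    have hx : Tendsto (fun a ↦ (a, y)) (𝓝 x) (𝓝 (x, y)) :=
      Continuous.tendsto' (by fun_prop) _ _ rfl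
    filter_upwards [hx.eventually ((hf.of_le hn).eventually (by simp))] with a ha
    exact fderiv_partial_right (ha.differentiableAt (by simp)) v
  have hD : DifferentiableAt 𝕜 (fderiv 𝕜 f) (x, y) := differentiableAt_fderiv hf hn
  have hDx : DifferentiableAt 𝕜 (fun a ↦ fderiv 𝕜 f (a, y)) x :=
    hD.comp x (hasFDerivAt_prodMk_left x y).differentiableAt
  rw [hpartial.fderiv_eq, fderiv_clm_apply hDx (differentiableAt_const _)]
  simp [fderiv_partial_left hD]

theorem fderiv_fderiv_left_apply (hf : ContDiffAt 𝕜 n f (x, y)) (hn : 2 ≤ n) (u : E) (v : F) :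
    fderiv 𝕜 (fun b ↦ fderiv 𝕜 (fun a ↦ f (a, b)) x u) y v =
      fderiv 𝕜 (fderiv 𝕜 f) (x, y) (0, v) (u, 0) := by
  have hpartial : (fun b ↦ fderiv 𝕜 (fun a ↦ f (a, b)) x u) =ᶠ[𝓝 y]
      fun b ↦ fderiv 𝕜 f (x, b) (u, 0) := by
    have hy : Tendsto (fun b ↦ (x, b)) (𝓝 y) (𝓝 (x, y)) :=
      Continuous.tendsto' (by fun_prop) _ _ rfl
    filter_upwards [hy.eventually ((hf.of_le hn).eventually (by simp))] with b hb
    exact fderiv_partial_left (hb.differentiableAt (by simp)) u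
  have hD : DifferentiableAt 𝕜 (fderiv 𝕜 f) (x, y) := differentiableAt_fderiv hf hn
  have hDy : DifferentiableAt 𝕜 (fun b ↦ fderiv 𝕜 f (x, b)) y :=
    hD.comp y (hasFDerivAt_prodMk_right x y).differentiableAt
  rw [hpartial.fderiv_eq, fderiv_clm_apply hDy (differentiableAt_const _)]
  simp [fderiv_partial_right hD]

theorem fderiv_fderiv_partial_comm (hf : ContDiffAt 𝕜 n f (x, y)) (hn : minSmoothness 𝕜 2 ≤ n)
    (u : E) (v : F) :
    fderiv 𝕜 (fun b ↦ fderiv 𝕜 (fun a ↦ f (a, b)) x u) y v =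
      fderiv 𝕜 (fun a ↦ fderiv 𝕜 (fun b ↦ f (a, b)) y v) x u := by
  have hn' : 2 ≤ n := le_minSmoothness.trans hn
  rw [fderiv_fderiv_left_apply hf hn', fderiv_fderiv_right_apply hf hn',
    (hf.isSymmSndFDerivAt hn).eq (0, v) (u, 0)]

end MixedDerivatives

section LocalGroupLaw

variable {𝕜 E : Type*} [NontriviallyNormedField 𝕜] [NormedAddCommGroup E] [NormedSpace 𝕜 E]
  {μ : E × E → E} {p : E} {n : ℕ∞ω} {A : E → E} {v w : E}

/-- Here `μ` is a local group law with unit `p`, so that `a ↦ ∂₂μ(a, p) v` is the left-invariant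
vector field of `v`, and `A a` plays the role of `Ad(a) w`. -/
theorem lieBracket_fderiv_right_eq_fderiv (hμ : ContDiffAt 𝕜 n μ (p, p))
    (hn : minSmoothness 𝕜 2 ≤ n) (hleft : ∀ᶠ b in 𝓝 p, μ (p, b) = b)
    (hright : ∀ᶠ a in 𝓝 p, μ (a, p) = a) (hA : DifferentiableAt 𝕜 A p)
    (hAμ : ∀ᶠ a in 𝓝 p,
      fderiv 𝕜 (fun b ↦ μ (a, b)) p w = fderiv 𝕜 (fun b ↦ μ (b, a)) p (A a)) :
    lieBracket 𝕜 (fun a ↦ fderiv 𝕜 (fun b ↦ μ (a, b)) p v)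
      (fun a ↦ fderiv 𝕜 (fun b ↦ μ (a, b)) p w) p = fderiv 𝕜 A p v := by
  have hR : DifferentiableAt 𝕜 (fun a ↦ fderiv 𝕜 (fun b ↦ μ (b, a)) p) p :=
    differentiableAt_fderiv_left hμ (le_minSmoothness.trans hn)
  have hL_one : fderiv 𝕜 (fun b ↦ μ (p, b)) p = .id 𝕜 E := by
    rw [EventuallyEq.fderiv_eq hleft, fderiv_fun_id]
  have hR_one : fderiv 𝕜 (fun b ↦ μ (b, p)) p = .id 𝕜 E := by
    rw [EventuallyEq.fderiv_eq hright, fderiv_fun_id]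
  have hA_one : A p = w := by simpa [hL_one, hR_one] using hAμ.self_of_nhds.symm
  have hproduct : fderiv 𝕜 (fun a ↦ fderiv 𝕜 (fun b ↦ μ (a, b)) p w) p v =
      fderiv 𝕜 A p v + fderiv 𝕜 (fun a ↦ fderiv 𝕜 (fun b ↦ μ (b, a)) p w) p v := by
    rw [EventuallyEq.fderiv_eq hAμ, fderiv_clm_apply hR hA,
      fderiv_clm_apply hR (differentiableAt_const w)]
    simp [hR_one, hA_one]
  simp [lieBracket, hL_one, hproduct, fderiv_fderiv_partial_comm hμ hn w v]

end LocalGroupLaw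

section ManifoldDerivatives

variable {𝕜 E E' F H H' M M' : Type*} [NontriviallyNormedField 𝕜]
  [NormedAddCommGroup E] [NormedSpace 𝕜 E] [NormedAddCommGroup E'] [NormedSpace 𝕜 E']
  [NormedAddCommGroup F] [NormedSpace 𝕜 F]
  [TopologicalSpace H] {I : ModelWithCorners 𝕜 E H}
  [TopologicalSpace H'] {I' : ModelWithCorners 𝕜 E' H'}
  [TopologicalSpace M] [ChartedSpace H M] [TopologicalSpace M'] [ChartedSpace H' M']

theorem mvfderiv_comp_apply {f : M → M'} {g : M' → F} {x : M}
    (hg : MDifferentiableAt I' 𝓘(𝕜, F) g (f x)) (hf : MDifferentiableAt I I' f x)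
    (v : TangentSpace I x) :
    mvfderiv I (g ∘ f) x v = mvfderiv I' g (f x) (mfderiv I I' f x v) :=
  congrArg (NormedSpace.fromTangentSpace (𝕜 := 𝕜) (g (f x))) (mfderiv_comp_apply x hg hf v)

theorem differentiableAt_comp_extChartAt_symm [I.Boundaryless] {f : M → F} {x : M}
    (hf : MDifferentiableAt I 𝓘(𝕜, F) f x) :
    DifferentiableAt 𝕜 (f ∘ (extChartAt I x).symm) (extChartAt I x x) := by
  have h : DifferentiableWithinAt 𝕜 (f ∘ (extChartAt I x).symm) (Set.range I)
      (extChartAt I x x) := hf.differentiableWithinAt_writtenInExtChartAt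
  rwa [I.range_eq_univ, differentiableWithinAt_univ] at h

theorem mvfderiv_apply_eq_fderiv [I.Boundaryless] {f : M → F} {x : M}
    (hf : MDifferentiableAt I 𝓘(𝕜, F) f x) (v : E) :
    mvfderiv I f x v = fderiv 𝕜 (f ∘ (extChartAt I x).symm) (extChartAt I x x) v := by
  rw [hf.mvfderiv, I.range_eq_univ, fderivWithin_univ]
  rfl

theorem fderiv_extChartAt_comp_symm [I.Boundaryless] [IsManifold I' 1 M'] {f : M → M'} {x : M}
    {y : M'} (hf : MDifferentiableAt I I' f x) (hy : f x ∈ (chartAt H' y).source) (v : E) :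
    fderiv 𝕜 (fun b ↦ extChartAt I' y (f ((extChartAt I x).symm b))) (extChartAt I x x) v =
      mvfderiv I' (extChartAt I' y) (f x) (mfderiv I I' f x v) := by
  have hchart : MDifferentiableAt I' 𝓘(𝕜, E') (extChartAt I' y) (f x) :=
    mdifferentiableAt_extChartAt hy
  exact (mvfderiv_apply_eq_fderiv (hchart.comp x hf) v).symm.trans
    (mvfderiv_comp_apply hchart hf v)

theorem inTangentCoordinates_eq_self {N : Type*} [IsManifold I 1 M] [IsManifold I' 1 M']
    {f : N → M} {g : N → M'} {x₀ x : N} (hf : f x = f x₀) (hg : g x = g x₀)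
    (ϕ : N → E →L[𝕜] E') : inTangentCoordinates I I' f g ϕ x₀ x = ϕ x := by
  rw [inTangentCoordinates_eq _ _ _ (by simp [hf]) (by simp [hg]), hf, hg]
  ext v
  exact ((tangentBundleCore I' M').coordChange_self _ _ (mem_chart_source H' (g x₀)) _).trans
    (congrArg (ϕ x) ((tangentBundleCore I M).coordChange_self _ _ (mem_chart_source H (f x₀)) v))

/-- If all the maps `f x` send `y` to the same point, their derivatives at `y` take values in the
same tangent space, and no change of coordinates is needed to compare them. -/
theorem contMDiff_mfderiv_apply_of_const {EN HN N : Type*} [NormedAddCommGroup EN]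
    [NormedSpace 𝕜 EN] [TopologicalSpace HN] {J : ModelWithCorners 𝕜 EN HN} [TopologicalSpace N]
    [ChartedSpace HN N] {m n : ℕ∞ω} [IsManifold J 1 N]
    [IsManifold I 1 M] [IsManifold I' 1 M'] {f : N → M → M'} {y : M} {z : M'}
    (hf : ContMDiff (J.prod I) I' n (Function.uncurry f))
    (hz : ∀ x, f x y = z) (hmn : m + 1 ≤ n) (v : E) :
    ContMDiff J 𝓘(𝕜, E') m (fun x ↦ (mfderiv I I' (f x) y v : E')) := by
  intro x₀
  have hcoord : ContMDiffAt J 𝓘(𝕜, E') m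
      (fun x ↦ inTangentCoordinates I I' (fun _ ↦ y) (fun x ↦ f x y) (fun x ↦ mfderiv I I' (f x) y)
        x₀ x v) x₀ :=
    (hf.contMDiffAt.mfderiv f (fun _ ↦ y) contMDiffAt_const hmn).clm_apply contMDiffAt_const
  refine hcoord.congr_of_eventuallyEq (.of_forall fun x ↦ ?_)
  have hself := inTangentCoordinates_eq_self (I := I) (I' := I') (f := fun _ : N ↦ y)
    (g := fun x ↦ f x y) (x₀ := x₀) (x := x) rfl (by rw [hz, hz]) (fun x ↦ mfderiv I I' (f x) y)
  exact congrArg (fun L : E →L[𝕜] E' ↦ L v) hself.symm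

end ManifoldDerivatives

section VectorFields

variable {𝕜 E H M : Type*} [NontriviallyNormedField 𝕜] [NormedAddCommGroup E] [NormedSpace 𝕜 E]
  [TopologicalSpace H] {I : ModelWithCorners 𝕜 E H} [TopologicalSpace M] [ChartedSpace H M]

/-- The vector field `Y` read in the preferred chart at `x`, a vector field on the model space. -/
noncomputable def chartVectorField (Y : (x : M) → TangentSpace I x) (x : M) (a : E) : E :=
  mvfderiv I (extChartAt I x) ((extChartAt I x).symm a) (Y ((extChartAt I x).symm a))

theorem mpullbackWithin_extChartAt_symm_eq_chartVectorField [IsManifold I 1 M]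
    (Y : (x : M) → TangentSpace I x) {x : M} {a : E} (ha : a ∈ (extChartAt I x).target) :
    mpullbackWithin 𝓘(𝕜, E) I (extChartAt I x).symm Y (Set.range I) a = chartVectorField Y x a := by
  have hinverse : (mfderivWithin 𝓘(𝕜, E) I (extChartAt I x).symm (Set.range I) a).inverse =
      mfderiv I 𝓘(𝕜, E) (extChartAt I x) ((extChartAt I x).symm a) :=
    ContinuousLinearMap.inverse_eq (mfderivWithin_extChartAt_symm_comp_mfderiv_extChartAt ha)
      (mfderiv_extChartAt_comp_mfderivWithin_extChartAt_symm ha)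
  rw [mpullbackWithin_apply, hinverse]
  rfl

theorem mlieBracket_eq_lieBracket_chartVectorField [I.Boundaryless] [IsManifold I 1 M]
    (Y Z : (x : M) → TangentSpace I x) (x : M) :
    (mlieBracket I Y Z x : E) =
      lieBracket 𝕜 (chartVectorField Y x) (chartVectorField Z x) (extChartAt I x x) := by
  have hchart (Y : (x : M) → TangentSpace I x) :
      (mpullbackWithin 𝓘(𝕜, E) I (extChartAt I x).symm Y (Set.range I) : E → E)
        =ᶠ[𝓝 (extChartAt I x x)] chartVectorField Y x := by
    filter_upwards [extChartAt_target_mem_nhds x] with a ha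
    exact mpullbackWithin_extChartAt_symm_eq_chartVectorField Y ha
  have hinverse : (mfderiv I 𝓘(𝕜, E) (extChartAt I x) x).inverse = .id 𝕜 E :=
    (congrArg (fun L : E →L[𝕜] E ↦ L.inverse) mfderiv_extChartAt_self).trans
      ContinuousLinearMap.inverse_id
  have hdomain : (extChartAt I x).symm ⁻¹' Set.univ ∩ Set.range I = Set.univ := by
    simp [I.range_eq_univ]
  have hbracket {Y' Z' : E → E} (hY : Y' =ᶠ[𝓝 (extChartAt I x x)] chartVectorField Y x)
      (hZ : Z' =ᶠ[𝓝 (extChartAt I x x)] chartVectorField Z x) :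
      lieBracketWithin 𝕜 Y' Z' ((extChartAt I x).symm ⁻¹' Set.univ ∩ Set.range I)
        (extChartAt I x x) =
      lieBracket 𝕜 (chartVectorField Y x) (chartVectorField Z x) (extChartAt I x x) := by
    rw [hdomain, lieBracketWithin_univ, hY.lieBracket_vectorField_eq hZ]
  exact (congrArg (fun L : E →L[𝕜] E ↦ L _) hinverse).trans (hbracket (hchart Y) (hchart Z))

end VectorFields

section RealManifolds

variable {E F H M : Type*} [NormedAddCommGroup E] [NormedSpace ℝ E] [NormedAddCommGroup F]
  [NormedSpace ℝ F] [TopologicalSpace H] {I : ModelWithCorners ℝ E H} [TopologicalSpace M]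
  [ChartedSpace H M]

theorem mvfderiv_eq_zero_of_isLocalMax [I.Boundaryless] {f : M → ℝ} {x : M}
    (h : IsLocalMax f x) : mvfderiv I f x = 0 := by
  by_cases hf : MDifferentiableAt I 𝓘(ℝ, ℝ) f x
  · have hchart : IsLocalMax (f ∘ (extChartAt I x).symm) (extChartAt I x x) := by
      have hsymm := continuousAt_extChartAt_symm (I := I) x
      rw [ContinuousAt, extChartAt_to_inv] at hsymm
      filter_upwards [hsymm.eventually h] with a ha
      simpa using ha
    ext v
    exact (mvfderiv_apply_eq_fderiv hf v).trans (by rw [hchart.fderiv_eq_zero]; rfl)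
  · rw [mvfderiv, mfderiv_zero_of_not_mdifferentiableAt hf, ContinuousLinearMap.comp_zero]

theorem hasDerivAt_comp_of_hasMFDerivAt {f : M → F} {γ : ℝ → M} {t : ℝ}
    {v : TangentSpace I (γ t)} (hf : MDifferentiableAt I 𝓘(ℝ, F) f (γ t))
    (hγ : HasMFDerivAt 𝓘(ℝ, ℝ) I γ t ((1 : ℝ →L[ℝ] ℝ).smulRight v)) :
    HasDerivAt (f ∘ γ) (mvfderiv I f (γ t) v) t := by
  have hcomp : HasMFDerivAt 𝓘(ℝ, ℝ) 𝓘(ℝ, F) (f ∘ γ) t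
      ((1 : ℝ →L[ℝ] ℝ).smulRight (mvfderiv I f (γ t) v)) := by
    refine (hf.hasMFDerivAt.comp t hγ).congr_mfderiv ?_
    ext
    exact (congrArg (mvfderiv I f (γ t)) (one_smul ℝ v)).trans (one_smul ℝ _).symm
  have hfderiv : HasFDerivAt (f ∘ γ) ((1 : ℝ →L[ℝ] ℝ).smulRight (mvfderiv I f (γ t) v)) t :=
    hasMFDerivAt_iff_hasFDerivAt.1 hcomp
  simpa using hfderiv.hasDerivAt

theorem eventually_eq_of_mvfderiv_eq_zero {f : M → F} {Y : (x : M) → TangentSpace I x}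
    {γ : ℝ → M} {t₀ : ℝ} (hf : MDifferentiable I 𝓘(ℝ, F) f) (hY : ∀ x, mvfderiv I f x (Y x) = 0)
    (hγ : IsMIntegralCurveAt γ Y t₀) : ∀ᶠ t in 𝓝 t₀, f (γ t) = f (γ t₀) := by
  obtain ⟨ε, hε, hball⟩ := Metric.eventually_nhds_iff_ball.1 hγ
  have hderiv (t) (ht : t ∈ Metric.ball t₀ ε) : HasDerivAt (f ∘ γ) 0 t := by
    simpa only [hY] using hasDerivAt_comp_of_hasMFDerivAt (hf (γ t)) (hball t ht)
  filter_upwards [Metric.ball_mem_nhds t₀ hε] with t ht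
  exact (convex_ball t₀ ε).is_const_of_fderivWithin_eq_zero (𝕜 := ℝ) (f := f ∘ γ)
    (fun s hs ↦ (hderiv s hs).differentiableAt.differentiableWithinAt)
    (fun s hs ↦ by
      rw [fderivWithin_of_isOpen Metric.isOpen_ball hs, (hderiv s hs).hasFDerivAt.fderiv]
      simp) ht (Metric.mem_ball_self hε)

theorem frequently_ne_of_isMIntegralCurveAt {Y : (x : M) → TangentSpace I x} {γ : ℝ → M} {t₀ : ℝ}
    (hγ : IsMIntegralCurveAt γ Y t₀) (hY : Y (γ t₀) ≠ 0) : ∃ᶠ t in 𝓝 t₀, γ t ≠ γ t₀ := by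
  intro hconst
  simp only [not_not] at hconst
  have hzero : HasMFDerivAt 𝓘(ℝ, ℝ) I γ t₀ 0 :=
    (hasMFDerivAt_const (γ t₀) t₀).congr_of_eventuallyEq hconst
  have hderiv := congrArg (fun L : ℝ →L[ℝ] E ↦ L 1) (hasMFDerivAt_unique hγ.hasMFDerivAt hzero)
  exact hY ((one_smul ℝ (Y (γ t₀))).symm.trans hderiv)

theorem IsLocalAttractor.exists_nhds_forall_isCriticalPoint_eq [T2Space M]
    {Y : ℝ → (x : M) → TangentSpace I x} {w : M} (h : IsLocalAttractor Y w) :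
    ∃ U ∈ 𝓝 w, ∀ y ∈ U, IsCriticalPoint Y y → y = w := by
  obtain ⟨-, U, hU, hattract⟩ := h
  refine ⟨U, hU, fun y hyU hy ↦ ?_⟩
  have hconst : IsIntegralCurve (fun _ : ℝ ↦ y) Y := fun t ↦ by
    rw [hy t, ContinuousLinearMap.smulRight_zero]
    exact hasMFDerivAt_const y t
  exact tendsto_nhds_unique tendsto_const_nhds (hattract 0 y hyU _ hconst rfl)

end RealManifolds

section CompactGroupRepresentations

theorem trace_le_finrank_of_norm_apply_le {V : Type*} [NormedAddCommGroup V]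
    [InnerProductSpace ℝ V] [FiniteDimensional ℝ V] {f : V →ₗ[ℝ] V} (hf : ∀ v, ‖f v‖ ≤ ‖v‖) :
    LinearMap.trace ℝ V f ≤ finrank ℝ V := by
  let b := stdOrthonormalBasis ℝ V
  calc LinearMap.trace ℝ V f = ∑ i, inner ℝ (b i) (f (b i)) := f.trace_eq_sum_inner b
    _ ≤ ∑ _i : Fin (finrank ℝ V), (1 : ℝ) := Finset.sum_le_sum fun i _ ↦
      calc inner ℝ (b i) (f (b i)) ≤ ‖b i‖ * ‖f (b i)‖ := real_inner_le_norm _ _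
        _ ≤ ‖b i‖ * ‖b i‖ := by gcongr; exact hf _
        _ = 1 := by simp
    _ = finrank ℝ V := by simp

/-- The inner product given by a symmetric positive definite bilinear form. -/
abbrev innerProductCoreOfPosDef {V : Type*} [AddCommGroup V] [Module ℝ V]
    {B : LinearMap.BilinForm ℝ V} (hsymm : B.IsSymm) (hpos : B.toQuadraticMap.PosDef) :
    InnerProductSpace.Core ℝ V where
  inner u v := B u v
  conj_inner_symm u v := hsymm.eq v u
  re_inner_nonneg := hpos.nonneg
  add_left u v w := by rw [map_add, LinearMap.add_apply]
  smul_left u v c := by rw [map_smul, LinearMap.smul_apply, smul_eq_mul, RCLike.conj_to_real]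
  definite u hu := hpos.anisotropic u hu

theorem trace_le_finrank_of_posDef {V : Type*} [AddCommGroup V] [Module ℝ V]
    [FiniteDimensional ℝ V] {B : LinearMap.BilinForm ℝ V} (hsymm : B.IsSymm)
    (hpos : B.toQuadraticMap.PosDef) {f : V →ₗ[ℝ] V} (hf : ∀ v, B (f v) (f v) ≤ B v v) :
    LinearMap.trace ℝ V f ≤ finrank ℝ V := by
  let core := innerProductCoreOfPosDef hsymm hpos
  let : NormedAddCommGroup V := core.toNormedAddCommGroup
  let : InnerProductSpace ℝ V := .ofCore core.toCore
  exact trace_le_finrank_of_norm_apply_le fun v ↦ Real.sqrt_le_sqrt (hf v)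

variable {G V : Type*} [Group G] [TopologicalSpace G] [CompactSpace G]
  [AddCommGroup V] [Module ℝ V] [TopologicalSpace V] [IsTopologicalAddGroup V]
  [ContinuousSMul ℝ V] [T2Space V] [FiniteDimensional ℝ V] {ρ : Representation ℝ G V}

omit [CompactSpace G] in
theorem continuous_inner_toEuclidean_representation (hρ : ∀ v, Continuous fun g ↦ ρ g v)
    (u v : V) : Continuous fun g ↦ inner ℝ (toEuclidean (ρ g u)) (toEuclidean (ρ g v)) :=
  (toEuclidean.continuous.comp (hρ u)).inner (toEuclidean.continuous.comp (hρ v))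

section

variable [MeasurableSpace G] (μ : Measure G)

theorem integrable_inner_toEuclidean_representation [OpensMeasurableSpace G]
    [IsFiniteMeasureOnCompacts μ] (hρ : ∀ v, Continuous fun g ↦ ρ g v) (u v : V) :
    Integrable (fun g ↦ inner ℝ (toEuclidean (ρ g u)) (toEuclidean (ρ g v))) μ :=
  (continuous_inner_toEuclidean_representation hρ u v).integrable_of_hasCompactSupport
    (.of_compactSpace _)

/-- The average over the group of the translates under a continuous representation of an auxiliary
Euclidean inner product (that of `toEuclidean`). -/
noncomputable def averagedForm [OpensMeasurableSpace G] [IsFiniteMeasureOnCompacts μ]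
    (hρ : ∀ v, Continuous fun g ↦ ρ g v) : LinearMap.BilinForm ℝ V :=
  LinearMap.mk₂ ℝ (fun u v ↦ ∫ g, inner ℝ (toEuclidean (ρ g u)) (toEuclidean (ρ g v)) ∂μ)
    (fun u u' v ↦ by
      simp only [map_add, inner_add_left]
      exact integral_add (integrable_inner_toEuclidean_representation μ hρ u v)
        (integrable_inner_toEuclidean_representation μ hρ u' v))
    (fun c u v ↦ by simp only [map_smul, real_inner_smul_left, integral_const_mul, smul_eq_mul])
    (fun u v v' ↦ by
      simp only [map_add, inner_add_right]
      exact integral_add (integrable_inner_toEuclidean_representation μ hρ u v)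
        (integrable_inner_toEuclidean_representation μ hρ u v'))
    (fun c u v ↦ by simp only [map_smul, real_inner_smul_right, integral_const_mul, smul_eq_mul])

variable [IsFiniteMeasureOnCompacts μ] (hρ : ∀ v, Continuous fun g ↦ ρ g v)

theorem averagedForm_isSymm [OpensMeasurableSpace G] : (averagedForm μ hρ).IsSymm where
  eq u v := by simp only [averagedForm, LinearMap.mk₂_apply, real_inner_comm]

theorem averagedForm_posDef [OpensMeasurableSpace G] [μ.IsOpenPosMeasure] :
    (averagedForm μ hρ).toQuadraticMap.PosDef := fun v hv ↦
  (continuous_inner_toEuclidean_representation hρ v v)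
    |>.integral_pos_of_hasCompactSupport_nonneg_nonzero (.of_compactSpace _)
      (fun _ ↦ real_inner_self_nonneg) (x := 1) (by simpa using hv)

theorem averagedForm_representation_apply [BorelSpace G] [ContinuousMul G] [μ.IsMulRightInvariant]
    (g : G) (u v : V) : averagedForm μ hρ (ρ g u) (ρ g v) = averagedForm μ hρ u v := by
  simpa only [averagedForm, LinearMap.mk₂_apply, map_mul, Module.End.mul_apply] using
    integral_mul_right_eq_self (μ := μ)
      (fun x ↦ inner ℝ (toEuclidean (ρ x u)) (toEuclidean (ρ x v))) g

end

theorem exists_invariant_posDef [IsTopologicalGroup G] (hρ : ∀ v, Continuous fun g ↦ ρ g v) :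
    ∃ B : LinearMap.BilinForm ℝ V, B.IsSymm ∧ B.toQuadraticMap.PosDef ∧
      ∀ g u v, B (ρ g u) (ρ g v) = B u v := by
  borelize G
  let μ : Measure G := Measure.haar.inv
  exact ⟨averagedForm μ hρ, averagedForm_isSymm μ hρ, averagedForm_posDef μ hρ,
    averagedForm_representation_apply μ hρ⟩

theorem trace_representation_le_finrank [IsTopologicalGroup G]
    (hρ : ∀ v, Continuous fun g ↦ ρ g v) (g : G) : LinearMap.trace ℝ V (ρ g) ≤ finrank ℝ V := by
  obtain ⟨B, hsymm, hpos, hB⟩ := exists_invariant_posDef hρ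
  exact trace_le_finrank_of_posDef hsymm hpos fun v ↦ (hB g v v).le

end CompactGroupRepresentations

section LieAlgebras

theorem le_center_of_isLieAbelian_of_lieInvariant {R L : Type*} [CommRing R] [LieRing L]
    [LieAlgebra R L] {B : LinearMap.BilinForm R L} (hB : B.lieInvariant L)
    (haniso : B.toQuadraticMap.Anisotropic) (J : LieIdeal R L) [hJ : IsLieAbelian J] :
    J ≤ LieAlgebra.center R L := by
  intro z hz
  rw [LieModule.mem_maxTrivSubmodule]
  intro x
  have hcomm : ⁅z, ⁅z, x⁆⁆ = 0 :=
    congrArg Subtype.val (hJ.trivial ⟨z, hz⟩ ⟨⁅z, x⁆, lie_mem_left R L J z x hz⟩)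
  have hisotropic : B ⁅z, x⁆ ⁅z, x⁆ = 0 := by rw [hB, hcomm, map_zero, neg_zero]
  rw [← lie_skew, haniso _ hisotropic, neg_zero]

theorem isSemisimple_of_lieInvariant_anisotropic {K L : Type*} [Field K] [LieRing L]
    [LieAlgebra K L] [FiniteDimensional K L] {B : LinearMap.BilinForm K L} (hB : B.lieInvariant L)
    (hsymm : B.IsSymm) (haniso : B.toQuadraticMap.Anisotropic)
    (hcenter : LieAlgebra.center K L = ⊥) : LieAlgebra.IsSemisimple K L := by
  have hnondeg : B.Nondegenerate :=
    ⟨fun u hu ↦ haniso u (hu u), fun u hu ↦ haniso u (hu u)⟩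
  refine LieAlgebra.InvariantForm.isSemisimple_of_nondegenerate B hnondeg hB hsymm.isRefl ?_
  intro J hJ habelian
  exact hJ.1 (le_bot_iff.1 (hcenter ▸ le_center_of_isLieAbelian_of_lieInvariant hB haniso J))

end LieAlgebras

section AdjointRepresentation

variable {E : Type*} [NormedAddCommGroup E] [NormedSpace ℝ E]
  {H : Type*} [TopologicalSpace H] {I : ModelWithCorners ℝ E H}
  {G : Type*} [TopologicalSpace G] [ChartedSpace H G] [Group G]

theorem Ad_eq_id_of_mem_center {x : G} (hx : x ∈ Subgroup.center G) :
    Ad I x = .id ℝ (GroupLieAlgebra I G) := by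
  have hconj : (fun y : G ↦ x * y * x⁻¹) = id := by
    ext y
    rw [← Subgroup.mem_center_iff.1 hx y, mul_inv_cancel_right, id]
  rw [Ad, hconj]
  exact mfderiv_id

theorem Ad_one : Ad I (1 : G) = .id ℝ (GroupLieAlgebra I G) :=
  Ad_eq_id_of_mem_center (one_mem _)

theorem mulInvariantVectorField_one (v : GroupLieAlgebra I G) :
    mulInvariantVectorField v (1 : G) = v := by
  have hone : (fun x : G ↦ 1 * x) = id := funext one_mul
  rw [mulInvariantVectorField, hone]
  exact congrArg (fun L : E →L[ℝ] E ↦ L v) (mfderiv_id (I := I) (x := (1 : G)))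

variable [LieGroup I ∞ G]

theorem mdifferentiableAt_conj (g x : G) : MDifferentiableAt I I (fun y : G ↦ g * y * g⁻¹) x :=
  mdifferentiableAt_mul_right.comp x mdifferentiableAt_mul_left

theorem Ad_mul_apply (x y : G) (v : GroupLieAlgebra I G) :
    Ad I (x * y) v = Ad I x (Ad I y v) := by
  have hconj : (fun z : G ↦ x * y * z * (x * y)⁻¹) =
      (fun z ↦ x * z * x⁻¹) ∘ (fun z ↦ y * z * y⁻¹) := by
    ext z
    simp only [Function.comp_apply, mul_inv_rev, mul_assoc]
  rw [Ad, hconj]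
  exact mfderiv_comp_apply_of_eq (1 : G) (mdifferentiableAt_conj (I := I) x 1)
    (mdifferentiableAt_conj (I := I) y 1) (by simp) v

theorem mulInvariantVectorField_eq_mfderiv_mul_right (x : G) (w : GroupLieAlgebra I G) :
    (mulInvariantVectorField w x : E) = mfderiv I I (fun y : G ↦ y * x) 1 (Ad I x w) := by
  have hleft : (fun z : G ↦ x * z) = (fun z ↦ z * x) ∘ (fun z ↦ x * z * x⁻¹) := by
    ext z
    simp only [Function.comp_apply, inv_mul_cancel_right]
  rw [mulInvariantVectorField, hleft]
  exact mfderiv_comp_apply_of_eq (1 : G) mdifferentiableAt_mul_right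
    (mdifferentiableAt_conj (I := I) x 1) (by simp) w

variable (I G) in
/-- The adjoint representation of a Lie group on its Lie algebra. -/
noncomputable def adRepresentation : Representation ℝ G (GroupLieAlgebra I G) where
  toFun x := Ad I x
  map_one' := by rw [Ad_one]; rfl
  map_mul' x y := LinearMap.ext (Ad_mul_apply x y)

variable (I) in
/-- The orbit map `x ↦ Ad(x) w` of the adjoint representation. It takes values in the model space
`E`, since Mathlib puts no norm on the tangent space, and the differential calculus needs one. -/
noncomputable def adOrbit (w : GroupLieAlgebra I G) (x : G) : E := Ad I x w

theorem contMDiff_adOrbit (w : GroupLieAlgebra I G) : ContMDiff I 𝓘(ℝ, E) ∞ (adOrbit I w) := by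
  have : IsManifold I 1 G := .of_le (n := ∞) (by simp)
  have hconj : ContMDiff (I.prod I) I ∞ (Function.uncurry fun x y : G ↦ x * y * x⁻¹) :=
    (contMDiff_fst.mul contMDiff_snd).mul contMDiff_fst.inv
  exact contMDiff_mfderiv_apply_of_const hconj (z := 1) (by simp) (by simp) w

theorem mdifferentiable_adOrbit (w : GroupLieAlgebra I G) :
    MDifferentiable I 𝓘(ℝ, E) (adOrbit I w) :=
  (contMDiff_adOrbit w).mdifferentiable (by simp)

end AdjointRepresentation

section GroupLawInChart

variable {E : Type*} [NormedAddCommGroup E] [NormedSpace ℝ E]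
  {H : Type*} [TopologicalSpace H] {I : ModelWithCorners ℝ E H} [I.Boundaryless]
  {G : Type*} [TopologicalSpace G] [ChartedSpace H G] [Group G]

variable (I G) in
/-- The group law read in the preferred chart at the identity. -/
noncomputable def chartMul (q : E × E) : E :=
  extChartAt I (1 : G) ((extChartAt I (1 : G)).symm q.1 * (extChartAt I (1 : G)).symm q.2)

theorem eventually_chartMul_one_right :
    ∀ᶠ b in 𝓝 (extChartAt I (1 : G) 1), chartMul I G (b, extChartAt I (1 : G) 1) = b := by
  filter_upwards [extChartAt_target_mem_nhds (I := I) (1 : G)] with b hb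
  simpa [chartMul] using (extChartAt I (1 : G)).right_inv hb

theorem eventually_chartMul_one_left :
    ∀ᶠ b in 𝓝 (extChartAt I (1 : G) 1), chartMul I G (extChartAt I (1 : G) 1, b) = b := by
  filter_upwards [extChartAt_target_mem_nhds (I := I) (1 : G)] with b hb
  simpa [chartMul] using (extChartAt I (1 : G)).right_inv hb

variable [LieGroup I ∞ G]

theorem contDiffAt_chartMul :
    ContDiffAt ℝ ∞ (chartMul I G) (extChartAt I (1 : G) 1, extChartAt I (1 : G) 1) := by
  have hsymm : ContMDiffAt 𝓘(ℝ, E) I ∞ (extChartAt I (1 : G)).symm (extChartAt I (1 : G) 1) :=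
    (contMDiffOn_extChartAt_symm (1 : G)).contMDiffAt (extChartAt_target_mem_nhds (1 : G))
  have hfst : ContMDiffAt 𝓘(ℝ, E × E) I ∞ (fun q : E × E ↦ (extChartAt I (1 : G)).symm q.1)
      (extChartAt I (1 : G) 1, extChartAt I (1 : G) 1) :=
    ContMDiffAt.comp (g := (extChartAt I (1 : G)).symm) _ hsymm contDiffAt_fst.contMDiffAt
  have hsnd : ContMDiffAt 𝓘(ℝ, E × E) I ∞ (fun q : E × E ↦ (extChartAt I (1 : G)).symm q.2)
      (extChartAt I (1 : G) 1, extChartAt I (1 : G) 1) :=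
    ContMDiffAt.comp (g := (extChartAt I (1 : G)).symm) _ hsymm contDiffAt_snd.contMDiffAt
  rw [← contMDiffAt_iff_contDiffAt]
  exact ContMDiffAt.comp_of_eq (g := extChartAt I (1 : G)) (y := 1) contMDiffAt_extChartAt
    (hfst.mul hsnd) (by simp)

theorem fderiv_chartMul_right {a : E} (ha : a ∈ (extChartAt I (1 : G)).target) (v : E) :
    fderiv ℝ (fun b ↦ chartMul I G (a, b)) (extChartAt I (1 : G) 1) v =
      chartVectorField (mulInvariantVectorField (I := I) (G := G) v) 1 a := by
  have : IsManifold I 1 G := .of_le (n := ∞) (by simp)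
  rw [chartVectorField]
  refine (fderiv_extChartAt_comp_symm (f := fun y : G ↦ (extChartAt I (1 : G)).symm a * y)
    mdifferentiableAt_mul_left
    (by simpa using (extChartAt I (1 : G)).map_target ha) v).trans ?_
  rw [mul_one]
  rfl

theorem fderiv_chartMul_left_adOrbit {a : E} (ha : a ∈ (extChartAt I (1 : G)).target)
    (w : GroupLieAlgebra I G) :
    fderiv ℝ (fun b ↦ chartMul I G (b, a)) (extChartAt I (1 : G) 1)
        (adOrbit I w ((extChartAt I (1 : G)).symm a)) =
      chartVectorField (mulInvariantVectorField w) (1 : G) a := by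
  have : IsManifold I 1 G := .of_le (n := ∞) (by simp)
  rw [chartVectorField]
  refine (fderiv_extChartAt_comp_symm (f := fun y : G ↦ y * (extChartAt I (1 : G)).symm a)
    mdifferentiableAt_mul_right
    (by simpa using (extChartAt I (1 : G)).map_target ha) _).trans ?_
  have hw := mulInvariantVectorField_eq_mfderiv_mul_right (I := I)
    ((extChartAt I (1 : G)).symm a) w
  rw [one_mul]
  exact congrArg (mvfderiv I (extChartAt I (1 : G)) ((extChartAt I (1 : G)).symm a)) hw.symm

theorem eventuallyEq_chartVectorField_mulInvariantVectorField (v : E) :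
    (fun a ↦ fderiv ℝ (fun b ↦ chartMul I G (a, b)) (extChartAt I (1 : G) 1) v)
      =ᶠ[𝓝 (extChartAt I (1 : G) 1)]
        chartVectorField (mulInvariantVectorField (I := I) (G := G) v) 1 := by
  filter_upwards [extChartAt_target_mem_nhds (I := I) (1 : G)] with a ha
  exact fderiv_chartMul_right ha v

theorem mvfderiv_adOrbit_one (v w : GroupLieAlgebra I G) :
    mvfderiv I (adOrbit I w) (1 : G) v = (⁅v, w⁆ : GroupLieAlgebra I G) := by
  have : IsManifold I 1 G := .of_le (n := ∞) (by simp)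
  have htwo : minSmoothness ℝ 2 ≤ (∞ : ℕ∞ω) := by simpa using (ENat.LEInfty.out : (2 : ℕ∞ω) ≤ ∞)
  have hAd : ∀ᶠ a in 𝓝 (extChartAt I (1 : G) 1),
      fderiv ℝ (fun b ↦ chartMul I G (a, b)) (extChartAt I (1 : G) 1) w =
        fderiv ℝ (fun b ↦ chartMul I G (b, a)) (extChartAt I (1 : G) 1)
          (adOrbit I w ((extChartAt I (1 : G)).symm a)) := by
    filter_upwards [extChartAt_target_mem_nhds (I := I) (1 : G)] with a ha
    exact (fderiv_chartMul_right ha w).trans (fderiv_chartMul_left_adOrbit ha w).symm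
  refine Eq.trans ?_ (mlieBracket_eq_lieBracket_chartVectorField _ _ _).symm
  calc (mvfderiv I (adOrbit I w) (1 : G) v : E)
    _ = fderiv ℝ (adOrbit I w ∘ (extChartAt I (1 : G)).symm) (extChartAt I (1 : G) 1) v :=
      mvfderiv_apply_eq_fderiv (mdifferentiable_adOrbit w 1) v
    _ = lieBracket ℝ (fun a ↦ fderiv ℝ (fun b ↦ chartMul I G (a, b)) (extChartAt I (1 : G) 1) v)
          (fun a ↦ fderiv ℝ (fun b ↦ chartMul I G (a, b)) (extChartAt I (1 : G) 1) w)
          (extChartAt I (1 : G) 1) :=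
      (lieBracket_fderiv_right_eq_fderiv contDiffAt_chartMul htwo eventually_chartMul_one_left
        eventually_chartMul_one_right
        (differentiableAt_comp_extChartAt_symm (mdifferentiable_adOrbit w 1)) hAd).symm
    _ = lieBracket ℝ (chartVectorField (mulInvariantVectorField v) (1 : G))
          (chartVectorField (mulInvariantVectorField w) (1 : G)) (extChartAt I (1 : G) 1) :=
      (eventuallyEq_chartVectorField_mulInvariantVectorField (E := E) v).lieBracket_vectorField_eq
        (eventuallyEq_chartVectorField_mulInvariantVectorField (E := E) w)

theorem mvfderiv_adOrbit_mulInvariantVectorField (x : G) (v w : GroupLieAlgebra I G) :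
    mvfderiv I (adOrbit I w) x (mulInvariantVectorField v x) = adOrbit I ⁅v, w⁆ x := by
  let A : E →L[ℝ] E := Ad I x
  have hequivariant : adOrbit I w ∘ (fun y ↦ x * y) = A ∘ adOrbit I w :=
    funext fun y ↦ Ad_mul_apply x y w
  have hA : MDifferentiableAt 𝓘(ℝ, E) 𝓘(ℝ, E) A (adOrbit I w (1 : G)) :=
    A.differentiableAt.mdifferentiableAt
  have hleft := mvfderiv_comp_apply (mdifferentiable_adOrbit w (x * 1))
    mdifferentiableAt_mul_left v
  rw [hequivariant, mul_one] at hleft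
  refine hleft.symm.trans ((mvfderiv_comp_apply hA (mdifferentiable_adOrbit w 1) v).trans ?_)
  have hderiv : (mvfderiv 𝓘(ℝ, E) A (adOrbit I w (1 : G)) : E →L[ℝ] E) = A :=
    mfderiv_eq_fderiv.trans A.fderiv
  exact (congrArg (fun L : E →L[ℝ] E ↦ L (mvfderiv I (adOrbit I w) (1 : G) v)) hderiv).trans
    (congrArg A (mvfderiv_adOrbit_one v w))

end GroupLawInChart

section LieAlgebraTopology

variable {E : Type*} [NormedAddCommGroup E] [NormedSpace ℝ E]
  {H : Type*} [TopologicalSpace H] {I : ModelWithCorners ℝ E H}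
  {G : Type*} [TopologicalSpace G] [ChartedSpace H G] [Group G]

instance [FiniteDimensional ℝ E] : FiniteDimensional ℝ (GroupLieAlgebra I G) :=
  inferInstanceAs (FiniteDimensional ℝ E)

instance : T2Space (GroupLieAlgebra I G) := inferInstanceAs (T2Space E)

theorem continuous_adRepresentation_apply [LieGroup I ∞ G] (w : GroupLieAlgebra I G) :
    Continuous fun x ↦ adRepresentation I G x w :=
  (contMDiff_adOrbit w).continuous

end LieAlgebraTopology

section LeftInvariantIntegralCurves

variable {E : Type*} [NormedAddCommGroup E] [NormedSpace ℝ E] [CompleteSpace E]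
  {H : Type*} [TopologicalSpace H] {I : ModelWithCorners ℝ E H} [I.Boundaryless]
  {G : Type*} [TopologicalSpace G] [ChartedSpace H G] [Group G] [LieGroup I ∞ G]

theorem exists_isMIntegralCurveAt_mulInvariantVectorField (v : GroupLieAlgebra I G) :
    ∃ γ : ℝ → G, γ 0 = 1 ∧ IsMIntegralCurveAt γ (mulInvariantVectorField v) 0 := by
  have : IsManifold I 1 G := .of_le (n := ∞) (by simp)
  exact exists_isMIntegralCurveAt_of_contMDiffAt_boundaryless (I := I) (t₀ := 0)
    ((contMDiffAt_mulInvariantVectorField (g := (1 : G)) v).of_le (by simp))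

variable [FiniteDimensional ℝ E]

theorem lieInvariant_of_Ad_invariant {B : LinearMap.BilinForm ℝ (GroupLieAlgebra I G)}
    (hB : ∀ (x : G) u v, B (Ad I x u) (Ad I x v) = B u v) :
    B.lieInvariant (GroupLieAlgebra I G) := by
  intro x y z
  obtain ⟨γ, hone, hγ⟩ := exists_isMIntegralCurveAt_mulInvariantVectorField x
  let C : E →L[ℝ] E →L[ℝ] ℝ :=
    LinearMap.toContinuousBilinearMap (show E →ₗ[ℝ] E →ₗ[ℝ] ℝ from B)
  have hderiv (w : GroupLieAlgebra I G) :
      HasDerivAt (adOrbit I w ∘ γ) (⁅x, w⁆ : GroupLieAlgebra I G) 0 := by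
    have h := hasDerivAt_comp_of_hasMFDerivAt (mdifferentiable_adOrbit w (γ 0)) hγ.hasMFDerivAt
    rw [mvfderiv_adOrbit_mulInvariantVectorField] at h
    rwa [hone, adOrbit, Ad_one] at h
  have hinvariant : (fun t ↦ C ((adOrbit I y ∘ γ) t) ((adOrbit I z ∘ γ) t)) = fun _ ↦ B y z :=
    funext fun t ↦ hB (γ t) y z
  have hsum := C.hasDerivAt_of_bilinear (fun _ ↦ hderiv y) (fun _ ↦ hderiv z)
  rw [hinvariant] at hsum
  have hone_apply (w : GroupLieAlgebra I G) : (adOrbit I w ∘ γ) 0 = w := by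
    rw [Function.comp_apply, hone, adOrbit, Ad_one]
    rfl
  rw [hone_apply, hone_apply] at hsum
  have hzero : B y ⁅x, z⁆ + B ⁅x, y⁆ z = 0 := hsum.unique (hasDerivAt_const _ _)
  linarith

theorem exists_ne_one_Ad_eq_id_of_mem_center {z : GroupLieAlgebra I G} (hz : z ≠ 0)
    (hcenter : z ∈ LieAlgebra.center ℝ (GroupLieAlgebra I G)) {U : Set G} (hU : U ∈ 𝓝 1) :
    ∃ g ∈ U, g ≠ 1 ∧ Ad I g = .id ℝ (GroupLieAlgebra I G) := by
  obtain ⟨γ, hone, hγ⟩ := exists_isMIntegralCurveAt_mulInvariantVectorField z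
  have hbracket (w : GroupLieAlgebra I G) : ⁅z, w⁆ = 0 := by
    rw [← lie_skew, (LieModule.mem_maxTrivSubmodule ℝ _ _ z).1 hcenter w, neg_zero]
  have hderiv (w : GroupLieAlgebra I G) (x : G) :
      mvfderiv I (adOrbit I w) x (mulInvariantVectorField z x) = 0 := by
    rw [mvfderiv_adOrbit_mulInvariantVectorField, hbracket, adOrbit, map_zero]
    rfl
  have hAd : ∀ᶠ t in 𝓝 0, Ad I (γ t) = .id ℝ (GroupLieAlgebra I G) := by
    let b := finBasis ℝ (GroupLieAlgebra I G)
    filter_upwards [eventually_all.2 fun i ↦ eventually_eq_of_mvfderiv_eq_zero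
      (mdifferentiable_adOrbit (b i)) (hderiv (b i)) hγ] with t ht
    refine ContinuousLinearMap.coe_injective (b.ext fun i ↦ (ht i).trans ?_)
    rw [hone, adOrbit, Ad_one]
    rfl
  have hγU : ∀ᶠ t in 𝓝 0, γ t ∈ U :=
    hγ.hasMFDerivAt.continuousAt.eventually_mem (by rwa [hone])
  have hne : ∃ᶠ t in 𝓝 0, γ t ≠ 1 := by
    rw [← hone]
    refine frequently_ne_of_isMIntegralCurveAt hγ ?_
    rw [hone, mulInvariantVectorField_one]
    exact hz
  obtain ⟨t, htne, htU, htAd⟩ := (hne.and_eventually (hγU.and hAd)).exists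
  exact ⟨γ t, htU, htne, htAd⟩

end LeftInvariantIntegralCurves

section TraceOfAdjoint

variable {E : Type*} [NormedAddCommGroup E] [NormedSpace ℝ E] [FiniteDimensional ℝ E]
  {H : Type*} [TopologicalSpace H] {I : ModelWithCorners ℝ E H}
  {G : Type*} [TopologicalSpace G] [ChartedSpace H G] [Group G]

theorem V_eq_finrank_of_Ad_eq_id {w : G} (hw : Ad I w = .id ℝ (GroupLieAlgebra I G)) :
    V I w = finrank ℝ (GroupLieAlgebra I G) := by
  rw [V, hw]
  exact LinearMap.trace_id ℝ _

variable [LieGroup I ∞ G] [CompactSpace G]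

theorem V_le_finrank (x : G) : V I x ≤ finrank ℝ (GroupLieAlgebra I G) := by
  have : IsTopologicalGroup G := topologicalGroup_of_lieGroup I ∞
  exact trace_representation_le_finrank continuous_adRepresentation_apply x

theorem isCriticalPoint_W_of_Ad_eq_id [I.Boundaryless] {m : ℕ} (X : Fin m → GroupLieAlgebra I G)
    (xr : ℝ → G) {w : G} (hw : Ad I w = .id ℝ (GroupLieAlgebra I G)) :
    IsCriticalPoint (W X xr) w := by
  have hmax : IsLocalMax (V I) w := Eventually.of_forall fun x ↦ by
    rw [V_eq_finrank_of_Ad_eq_id hw]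
    exact V_le_finrank x
  intro t
  refine Finset.sum_eq_zero fun k _ ↦ ?_
  have hcoeff : a X xr k t w = 0 :=
    congrArg (fun L : E →L[ℝ] ℝ ↦ L (adField X xr k t w)) (mvfderiv_eq_zero_of_isLocalMax hmax)
  rw [hcoeff, zero_smul]

end TraceOfAdjoint

section CompactLieGroups

variable {E : Type*} [NormedAddCommGroup E] [NormedSpace ℝ E] [FiniteDimensional ℝ E]
  [CompleteSpace E] {H : Type*} [TopologicalSpace H] {I : ModelWithCorners ℝ E H} [I.Boundaryless]
  {G : Type*} [TopologicalSpace G] [ChartedSpace H G] [Group G] [LieGroup I ∞ G] [CompactSpace G]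

theorem isSemisimple_groupLieAlgebra_of_center_eq_bot
    (hcenter : LieAlgebra.center ℝ (GroupLieAlgebra I G) = ⊥) :
    LieAlgebra.IsSemisimple ℝ (GroupLieAlgebra I G) := by
  have : IsTopologicalGroup G := topologicalGroup_of_lieGroup I ∞
  obtain ⟨B, hsymm, hpos, hB⟩ :=
    exists_invariant_posDef (continuous_adRepresentation_apply (I := I) (G := G))
  exact isSemisimple_of_lieInvariant_anisotropic (lieInvariant_of_Ad_invariant hB) hsymm
    hpos.anisotropic hcenter

end CompactLieGroups

end PeriodicTracking

open PeriodicTracking in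
theorem mainTheorem5_general
    {E : Type*} [NormedAddCommGroup E] [NormedSpace ℝ E] [FiniteDimensional ℝ E]
    [CompleteSpace E]
    {H : Type*} [TopologicalSpace H] (I : ModelWithCorners ℝ E H) [I.Boundaryless]
    {G : Type*} [TopologicalSpace G] [ChartedSpace H G] [Group G] [LieGroup I ∞ G]
    [CompactSpace G]
    {m : ℕ} (X : Fin m → GroupLieAlgebra I G) (xr : ℝ → G) :
    (∀ w ∈ Subgroup.center G, IsCriticalPoint (W X xr) w) ∧
    (IsLocalAttractor (W X xr) (1 : G) → LieAlgebra.IsSemisimple ℝ (GroupLieAlgebra I G)) := by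
  refine ⟨fun w hw ↦ isCriticalPoint_W_of_Ad_eq_id X xr (Ad_eq_id_of_mem_center hw),
    fun hattractor ↦ isSemisimple_groupLieAlgebra_of_center_eq_bot ?_⟩
  have : T1Space G := I.t1Space G
  have : IsTopologicalGroup G := topologicalGroup_of_lieGroup I ∞
  obtain ⟨U, hU, hisolated⟩ := hattractor.exists_nhds_forall_isCriticalPoint_eq
  refine (LieSubmodule.eq_bot_iff _).2 fun z hz ↦ by_contra fun hz0 ↦ ?_
  obtain ⟨g, hgU, hg, hAd⟩ := exists_ne_one_Ad_eq_id_of_mem_center hz0 hz hU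
  exact hg (hisolated g hgU (isCriticalPoint_W_of_Ad_eq_id X xr hAd))

theorem mainTheorem5
    {E : Type*} [NormedAddCommGroup E] [NormedSpace ℝ E] [FiniteDimensional ℝ E]
    [CompleteSpace E]
    {H : Type*} [TopologicalSpace H] (I : ModelWithCorners ℝ E H) [I.Boundaryless]
    {G : Type*} [TopologicalSpace G] [ChartedSpace H G] [Group G] [LieGroup I ∞ G]
    [T2Space G] [CompactSpace G] [ConnectedSpace G]
    {m : ℕ} (X : Fin m → GroupLieAlgebra I G) (hX : PeriodicTracking.IsBracketGenerating X)
    (T : ℝ) (xr : ℝ → G) (ur : Fin m → ℝ → ℝ)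
    (hr : PeriodicTracking.IsPeriodicTrajectory X T xr ur) :
    (∀ w ∈ Subgroup.center G, PeriodicTracking.IsCriticalPoint (PeriodicTracking.W X xr) w) ∧
    (PeriodicTracking.IsLocalAttractor (PeriodicTracking.W X xr) (1 : G) →
      LieAlgebra.IsSemisimple ℝ (GroupLieAlgebra I G)) :=
  mainTheorem5_general I X xr
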